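/- Let $f_0=f_1=1$ and $f_n=f_{n-1}+f_{n-2}$ for $n\ge 2$. Let $p=(p_k)_{k\ge0}$ be a bounded sequence of strictly positive real numbers and let $q=(q_n)_{n\ge0}$ be a non-decreasing bounded sequence of strictly positive real numbers. For a bounded sequence $r=(r_k)$ of strictly positive reals define the following sets of real sequences $x=(x_k)_{k\ge 0}$: $$c_0(r)=\{x:\lim_k|x_k|^{r_k}=0\},\qquad c(r)=\{x:\exists l\in\mathbb R,\ \lim_k|x_k-l|^{r_k}=0\},\qquad \ell_\infty(r)=\{x:\sup_k|x_k|^{r_k}<\infty\},$$ and let $$c_0(\widehat F,p)=\Big\{x:\lim_{n}\Big|\tfrac{f_n}{f_{n+1}}x_n-\tfrac{f_{n+1}}{f_n}x_{n-1}\Big|^{p_n}=0\Big\}\qquad(x_{-1}:=0).$$ For sets $X,Y$ of real sequences, $(X:Y)$ denotes the set of infinite real matrices $A=(a_{nk})_{n,k\ge0}$ such that for every $x\in X$ the series $(Ax)_n=\sum_{k=0}^\infty a_{nk}x_k$ converges for every $n$ and $Ax=((Ax)_n)_n\in Y$. Let $A=(a_{nk})$ be an infinite real matrix and put $$e^{(n)}_{mk}=\sum_{j=k}^m\frac{f_{j+1}^2}{f_kf_{k+1}}a_{nj}\quad(0\le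 k\le m),\qquad e_{nk}=\lim_{m\to\infty}e^{(n)}_{mk}=\sum_{j=k}^\infty\frac{f_{j+1}^2}{f_kf_{k+1}}a_{nj},$$ where the existence of the limits $e_{nk}$ is guaranteed by condition (1) below. Let $L,M$ denote positive integers and $K$ finite subsets of $\mathbb N=\{0,1,2,\dots\}$. Consider the conditions 1. for every $n$ there is a real sequence $(\alpha^{(n)}_k)_k$ with $\lim_{m\to\infty}|e^{(n)}_{mk}-\alpha^{(n)}_k|=0$ for all $k$; 2. for every $n$: $\exists M$, $\ \sup_{m}\sum_{k=0}^m|e^{(n)}_{mk}|M^{-1/p_k}<\infty$; 3. for every $n$: $\forall L\ \exists M$, $\ \sup_{m}\sum_{k=0}^m|e^{(n)}_{mk}|L^{1/q_n}M^{-1/p_k}<\infty$; 4. $\exists M$, $\ \sup_{n}\sup_{K}\big(\sum_{k\in K}|e_{nk}|M^{-1/p_k}\big)^{q_n}<\infty$; 5. $\lim_{n\to\infty}|e_{nk}|^{q_n}=0$ for all $k$; 6. $\forall L\ \exists M$, $\ \sup_n\sum_{k}|e_{nk}|L^{1/q_n}M^{-1/p_k}<\infty$; 7. $\lim_{n\to\infty}|e_{nk}-\alpha_k|^{q_n}=0$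 for all $k$; 8. $\exists M$, $\ \sup_n\sum_k|e_{nk}|M^{-1/p_k}<\infty$; 9. $\forall L\ \exists M$, $\ \sup_n\sum_k|e_{nk}-\alpha_k|L^{1/q_n}M^{-1/p_k}<\infty$. Then: (i) $A\in(c_0(\widehat F,p):\ell_\infty(q))$ if and only if (1), (2), (3) and (4) hold. (ii) $A\in(c_0(\widehat F,p):c_0(q))$ if and only if (1), (2), (3), (5) and (6) hold. (iii) $A\in(c_0(\widehat F,p):c(q))$ if and only if (1), (2), (3) hold and there is a real sequence $(\alpha_k)$ such that (7), (8) and (9) hold. -/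

import Mathlib

open Filter Topology
open scoped ENNReal

noncomputable section

namespace FibMaddox

/-- The Fibonacci numbers with the convention `f 0 = f 1 = 1`, as real numbers. -/
def f (n : ℕ) : ℝ := (Nat.fib (n + 1) : ℝ)

/-- Maddox's space `c₀(p)` of real sequences. -/
def c0 (p : ℕ → ℝ) : Set (ℕ → ℝ) :=
  {x | Tendsto (fun k => |x k| ^ p k) atTop (𝓝 0)}

/-- Maddox's space `c(p)` of real sequences. -/
def c (p : ℕ → ℝ) : Set (ℕ → ℝ) :=
  {x | ∃ l : ℝ, Tendsto (fun k => |x k - l| ^ p k) atTop (𝓝 0)}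

/-- Maddox's space `ℓ_∞(p)` of real sequences. -/
def ellInfty (p : ℕ → ℝ) : Set (ℕ → ℝ) :=
  {x | BddAbove (Set.range fun k => |x k| ^ p k)}

/-- The Fibonacci difference transform
`(F̂ x) n = (f n / f (n+1)) x n - (f (n+1) / f n) x (n-1)`, with `x (-1) = 0`. -/
def fibTransform (x : ℕ → ℝ) : ℕ → ℝ
  | 0 => f 0 / f 1 * x 0
  | n + 1 => f (n + 1) / f (n + 2) * x (n + 1) - f (n + 2) / f (n + 1) * x n

/-- The space `c₀(F̂, p)`. -/
def c0Fib (p : ℕ → ℝ) : Set (ℕ → ℝ) := {x | fibTransform x ∈ c0 p}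

/-- `y` is the `A`-transform of `x`: for every `n` the series `∑ k, A n k * x k` converges
(as a limit of partial sums, possibly only conditionally) to `y n`. -/
def IsTransform (A : Matrix ℕ ℕ ℝ) (x y : ℕ → ℝ) : Prop :=
  ∀ n, Tendsto (fun m => ∑ k ∈ Finset.range m, A n k * x k) atTop (𝓝 (y n))

/-- The class `(X : Y)` of infinite matrices that map `X` into `Y`. -/
def matrixClass (X Y : Set (ℕ → ℝ)) : Set (Matrix ℕ ℕ ℝ) :=
  {A | ∀ x ∈ X, ∃ y ∈ Y, IsTransform A x y}

/-- The partial sum `∑_{j=k}^m f_{j+1}² / (f_k f_{k+1}) a_{nj}`. -/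
def partialE (A : Matrix ℕ ℕ ℝ) (n m k : ℕ) : ℝ :=
  ∑ j ∈ Finset.Icc k m, f (j + 1) ^ 2 / (f k * f (k + 1)) * A n j

/-- The transformed matrix `e_{nk} = ∑_{j=k}^∞ f_{j+1}² / (f_k f_{k+1}) a_{nj}`, a possibly
conditionally convergent series. It is meaningful only under `PartialConv A`; wherever it is
used, that condition is imposed alongside. -/
def E (A : Matrix ℕ ℕ ℝ) : Matrix ℕ ℕ ℝ :=
  fun n k => limUnder atTop fun m => partialE A n m k

/-- For every `n` there is a real sequence `(α_k)` to which `partialE A n m k` tends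
as `m → ∞`, for all `k`. -/
def PartialConv (A : Matrix ℕ ℕ ℝ) : Prop :=
  ∀ n, ∃ α : ℕ → ℝ, ∀ k, Tendsto (fun m => |partialE A n m k - α k|) atTop (𝓝 0)

/-- For every `n`: `∃ M, sup_m ∑_{k=0}^m |partialE A n m k| M^{-1/p_k} < ∞`. -/
def PartialBdd (p : ℕ → ℝ) (A : Matrix ℕ ℕ ℝ) : Prop :=
  ∀ n, ∃ M : ℕ, 1 ≤ M ∧ BddAbove (Set.range fun m : ℕ =>
    ∑ k ∈ Finset.range (m + 1), |partialE A n m k| * (M : ℝ) ^ (-(1 / p k)))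

/-- For every `n`: `∀ L, ∃ M, sup_m ∑_{k=0}^m |partialE A n m k| L^{1/q_n} M^{-1/p_k} < ∞`. -/
def PartialBddL (p q : ℕ → ℝ) (A : Matrix ℕ ℕ ℝ) : Prop :=
  ∀ n, ∀ L : ℕ, 1 ≤ L → ∃ M : ℕ, 1 ≤ M ∧ BddAbove (Set.range fun m : ℕ =>
    ∑ k ∈ Finset.range (m + 1),
      |partialE A n m k| * (L : ℝ) ^ (1 / q n) * (M : ℝ) ^ (-(1 / p k)))

/-- `∃ M, sup_{n, K} (∑_{k ∈ K} |e_{nk}| M^{-1/p_k})^{q_n} < ∞`, with `K` running over the finite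
sets of indices. -/
def PowBdd (p q : ℕ → ℝ) (e : Matrix ℕ ℕ ℝ) : Prop :=
  ∃ M : ℕ, 1 ≤ M ∧ BddAbove (Set.range fun s : ℕ × Finset ℕ =>
    (∑ k ∈ s.2, |e s.1 k| * (M : ℝ) ^ (-(1 / p k))) ^ q s.1)

/-- `lim_n |e_{nk} - α_k|^{q_n} = 0` for all `k`. -/
def ColLim (q : ℕ → ℝ) (e : Matrix ℕ ℕ ℝ) (α : ℕ → ℝ) : Prop :=
  ∀ k, Tendsto (fun n => |e n k - α k| ^ q n) atTop (𝓝 0)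

/-- `lim_n |e_{nk}|^{q_n} = 0` for all `k`. -/
def ColNull (q : ℕ → ℝ) (e : Matrix ℕ ℕ ℝ) : Prop :=
  ∀ k, Tendsto (fun n => |e n k| ^ q n) atTop (𝓝 0)

/-- `∃ M, sup_n ∑_k |e_{nk}| M^{-1/p_k} < ∞`; the series are taken in `[0, ∞]`. -/
def RowBdd (p : ℕ → ℝ) (e : Matrix ℕ ℕ ℝ) : Prop :=
  ∃ M : ℕ, 1 ≤ M ∧
    (⨆ n, ∑' k, ENNReal.ofReal (|e n k| * (M : ℝ) ^ (-(1 / p k)))) < ∞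

/-- `∀ L, ∃ M, sup_n ∑_k |d_{nk}| L^{1/q_n} M^{-1/p_k} < ∞`; the series are taken in `[0, ∞]`. -/
def RowBddL (p q : ℕ → ℝ) (d : Matrix ℕ ℕ ℝ) : Prop :=
  ∀ L : ℕ, 1 ≤ L → ∃ M : ℕ, 1 ≤ M ∧
    (⨆ n, ∑' k, ENNReal.ofReal
      (|d n k| * (L : ℝ) ^ (1 / q n) * (M : ℝ) ^ (-(1 / p k)))) < ∞

end FibMaddox

end

namespace FibMaddox

/-! Since `q` is monotone, positive and bounded, its values lie in a compact subinterval of `(0,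
∞)`. Hence the target spaces are the classical `ℓ_∞`, `c₀`, `c`, the factors `L^{1/q_n}` are
harmless, and the weighted boundedness conditions all become instances of `WeightBdd`. The Fibonacci
transform is a bijection, and the partial sums of `A x` are `partialE` applied to `y = F̂ x ∈ c₀(p)`
(`sum_mul_fibInverse`).

What remains is a uniform boundedness principle on `c₀(p)`: a family of rows, each absolutely
summable against `c₀(p)`, is pointwise bounded there iff it satisfies `WeightBdd`. For necessity,
`c₀(p)` contains every `N_k^{-1/p_k} u_k` with `N → ∞` and `u` bounded; Banach–Steinhaus on bounded
sequences bounds the rows for each such `N`, and a gliding hump replaces `N` by a constant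
(`weightBdd_of_forall_tendsto`). Conversely, under `WeightBdd` column limits pass through the sum
(`WeightBdd.tendsto_tsum`). This is used twice: on `partialE A n` as `m → ∞`, and on `E A` as `n →
∞`. -/

/-! ### Sequences in `c₀(p)` and the weights `M^{-1/p_k}` -/

/-- The family `b` of rows is uniformly summable against some weight `M ^ (-1 / p k)`. -/
def WeightBdd {ι : Type*} (p : ℕ → ℝ) (b : ι → ℕ → ℝ) : Prop :=
  ∃ M : ℕ, 1 ≤ M ∧ ∃ C : ℝ, ∀ i m,
    ∑ k ∈ Finset.range m, |b i k| * (M : ℝ) ^ (-(1 / p k)) ≤ C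

theorem weight_pos {M : ℕ} (hM : 1 ≤ M) (s : ℝ) : 0 < (M : ℝ) ^ s :=
  Real.rpow_pos_of_pos (by exact_mod_cast hM) s

/-- The `p_k`-th power of the weight is `M⁻¹`, independent of `k`, and `δ^{p_k} ≥ δ^H` for `δ ≤ 1`
and `H` an upper bound of `p`. -/
theorem eventually_le_of_mem_c0 {p y : ℕ → ℝ} (hp : ∀ k, 0 < p k)
    (hpb : BddAbove (Set.range p)) (hy : y ∈ c0 p) {M : ℕ} (hM : 1 ≤ M) {ε : ℝ} (hε : 0 < ε) :
    ∀ᶠ k in atTop, |y k| ≤ ε * (M : ℝ) ^ (-(1 / p k)) := by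
  obtain ⟨H, hH⟩ := hpb
  have hM0 : (0 : ℝ) < M := by exact_mod_cast hM
  set δ := min ε 1
  have hδ : 0 < δ := lt_min hε one_pos
  have hy' : Tendsto (fun k => |y k| ^ p k) atTop (𝓝 0) := hy
  have hc : 0 < δ ^ H * (M : ℝ)⁻¹ := mul_pos (Real.rpow_pos_of_pos hδ H) (inv_pos.2 hM0)
  filter_upwards [hy'.eventually (gt_mem_nhds hc)] with k hk
  have hw := weight_pos hM (-(1 / p k))
  suffices h : |y k| ≤ δ * (M : ℝ) ^ (-(1 / p k)) from
    h.trans (mul_le_mul_of_nonneg_right (min_le_left _ _) hw.le)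
  rw [← Real.rpow_le_rpow_iff (abs_nonneg _) (by positivity) (hp k),
    Real.mul_rpow hδ.le hw.le, ← Real.rpow_mul hM0.le,
    show -(1 / p k) * p k = -1 by field_simp [(hp k).ne'], Real.rpow_neg_one]
  refine hk.le.trans (mul_le_mul_of_nonneg_right ?_ (inv_pos.2 hM0).le)
  exact Real.rpow_le_rpow_of_exponent_ge hδ (min_le_right _ _) (hH ⟨k, rfl⟩)

theorem exists_forall_le_of_mem_c0 {p y : ℕ → ℝ} (hp : ∀ k, 0 < p k)
    (hpb : BddAbove (Set.range p)) (hy : y ∈ c0 p) {M : ℕ} (hM : 1 ≤ M) :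
    ∃ C, 0 ≤ C ∧ ∀ k, |y k| ≤ C * (M : ℝ) ^ (-(1 / p k)) := by
  obtain ⟨N, hN⟩ := eventually_atTop.1 (eventually_le_of_mem_c0 hp hpb hy hM one_pos)
  have h0 : ∀ k, 0 ≤ |y k| / (M : ℝ) ^ (-(1 / p k)) := fun k =>
    div_nonneg (abs_nonneg _) (weight_pos hM _).le
  have hs : 0 ≤ ∑ k ∈ Finset.range N, |y k| / (M : ℝ) ^ (-(1 / p k)) :=
    Finset.sum_nonneg fun k _ => h0 k
  refine ⟨1 + ∑ k ∈ Finset.range N, |y k| / (M : ℝ) ^ (-(1 / p k)), by linarith, fun k => ?_⟩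
  rcases le_or_gt N k with h | h
  · exact (hN k h).trans (mul_le_mul_of_nonneg_right (by linarith) (weight_pos hM _).le)
  · rw [← div_le_iff₀ (weight_pos hM _)]
    have := Finset.single_le_sum (fun k _ => h0 k) (Finset.mem_range.2 h)
    linarith

/-- Supplies the test sequences for the necessity direction: the `p_k`-th power is `N_k⁻¹
|u_k|^{p_k}`, whose second factor stays bounded. -/
theorem mul_weight_mem_c0 {p u : ℕ → ℝ} {N : ℕ → ℕ} (hp : ∀ k, 0 < p k)
    (hpb : BddAbove (Set.range p)) (hN : Tendsto N atTop atTop) {C : ℝ} (hu : ∀ k, |u k| ≤ C) :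
    (fun k => (N k : ℝ) ^ (-(1 / p k)) * u k) ∈ c0 p := by
  obtain ⟨H, hH⟩ := hpb
  have hN' : Tendsto (fun k => (N k : ℝ)) atTop atTop := tendsto_natCast_atTop_atTop.comp hN
  have hlim : Tendsto (fun k => (N k : ℝ)⁻¹ * max C 1 ^ H) atTop (𝓝 0) := by
    simpa using (tendsto_inv_atTop_zero.comp hN').mul_const (max C 1 ^ H)
  refine squeeze_zero (fun k => Real.rpow_nonneg (abs_nonneg _) _) (fun k => ?_) hlim
  have hn : (0 : ℝ) ≤ N k := Nat.cast_nonneg _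
  rw [abs_mul, abs_of_nonneg (Real.rpow_nonneg hn _),
    Real.mul_rpow (Real.rpow_nonneg hn _) (abs_nonneg _), ← Real.rpow_mul hn,
    show -(1 / p k) * p k = -1 by field_simp [(hp k).ne'], Real.rpow_neg_one]
  refine mul_le_mul_of_nonneg_left ?_ (inv_nonneg.2 hn)
  calc |u k| ^ p k ≤ max C 1 ^ p k :=
        Real.rpow_le_rpow (abs_nonneg _) ((hu k).trans (le_max_left _ _)) (hp k).le
    _ ≤ _ := Real.rpow_le_rpow_of_exponent_le (le_max_right _ _) (hH ⟨k, rfl⟩)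

/-! ### Uniform boundedness on `c₀(p)` -/

/-- The functional on bounded sequences given by a summable sequence. -/
noncomputable def pairing (a : ℕ → ℝ) (ha : Summable fun k => |a k|) :
    (BoundedContinuousFunction ℕ ℝ) →L[ℝ] ℝ :=
  have hs : ∀ u : BoundedContinuousFunction ℕ ℝ, Summable fun k => a k * u k := fun u =>
    .of_norm_bounded (ha.mul_right ‖u‖) fun k => by
      rw [norm_mul]; exact mul_le_mul_of_nonneg_left (u.norm_coe_le_norm k) (norm_nonneg _)
  LinearMap.mkContinuous
    { toFun := fun u => ∑' k, a k * u k
      map_add' := fun u v => by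
        simp only [BoundedContinuousFunction.coe_add, Pi.add_apply, mul_add]
        exact (hs u).tsum_add (hs v)
      map_smul' := fun c u => by
        simp only [BoundedContinuousFunction.coe_smul, smul_eq_mul, RingHom.id_apply,
          ← tsum_mul_left, mul_left_comm] }
    (∑' k, |a k|) fun u =>
      tsum_of_norm_bounded (ha.mul_right ‖u‖).hasSum (fun k => by
        rw [norm_mul]; exact mul_le_mul_of_nonneg_left (u.norm_coe_le_norm k) (norm_nonneg _))
        |>.trans_eq tsum_mul_right

theorem pairing_apply (a : ℕ → ℝ) (ha : Summable fun k => |a k|)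
    (u : BoundedContinuousFunction ℕ ℝ) : pairing a ha u = ∑' k, a k * u k := rfl

/-- Uniform boundedness for summable sequences acting on bounded sequences. -/
theorem exists_tsum_abs_le {ι : Type*} {a : ι → ℕ → ℝ} (ha : ∀ i, Summable fun k => |a i k|)
    (h : ∀ u : ℕ → ℝ, ∀ B, (∀ k, |u k| ≤ B) → ∃ C, ∀ i, |∑' k, a i k * u k| ≤ C) :
    ∃ C, ∀ i, ∑' k, |a i k| ≤ C := by
  obtain ⟨C, hC⟩ := banach_steinhaus (g := fun i => pairing (a i) (ha i)) fun u =>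
    h u ‖u‖ fun k => u.norm_coe_le_norm k
  refine ⟨C, fun i => ?_⟩
  have hsign : ∀ k, ‖SignType.cast (α := ℝ) (SignType.sign (a i k))‖ ≤ 1 := fun k => by
    rcases lt_trichotomy (a i k) 0 with h | h | h <;> simp [h]
  -- The sign sequence of the row attains its `ℓ¹` norm.
  set s : BoundedContinuousFunction ℕ ℝ :=
    BoundedContinuousFunction.ofNormedAddCommGroupDiscrete
      (fun k => SignType.cast (SignType.sign (a i k))) 1 hsign
  have hs1 : ‖s‖ ≤ 1 := (BoundedContinuousFunction.norm_le zero_le_one).2 hsign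
  have he : pairing (a i) (ha i) s = ∑' k, |a i k| := by
    rw [pairing_apply]
    exact tsum_congr fun k => self_mul_sign (a i k)
  calc ∑' k, |a i k| = pairing (a i) (ha i) s := he.symm
    _ ≤ ‖pairing (a i) (ha i) s‖ := le_abs_self _
    _ ≤ ‖pairing (a i) (ha i)‖ * ‖s‖ := ContinuousLinearMap.le_opNorm _ _
    _ ≤ ‖pairing (a i) (ha i)‖ := mul_le_of_le_one_right (norm_nonneg (pairing (a i) (ha i))) hs1
    _ ≤ C := hC i

/-- If the rows are uniformly summable against `N k ^ (-1 / p k)` for every `N → ∞`, then they are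
so for a constant `N`. -/
theorem weightBdd_of_forall_tendsto {ι : Type*} {p : ℕ → ℝ} {b : ι → ℕ → ℝ}
    (h : ∀ N : ℕ → ℕ, (∀ k, 1 ≤ N k) → Tendsto N atTop atTop →
      ∃ C, ∀ i m, ∑ k ∈ Finset.range m, |b i k| * (N k : ℝ) ^ (-(1 / p k)) ≤ C) :
    WeightBdd p b := by
  by_contra hcon
  have hcon' : ∀ M : ℕ, 1 ≤ M → ∀ C : ℝ, ∃ i m,
      C < ∑ k ∈ Finset.range m, |b i k| * (M : ℝ) ^ (-(1 / p k)) := by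
    simpa [WeightBdd] using hcon
  have hpos : ∀ (M : ℕ) i k, 0 ≤ |b i k| * (M : ℝ) ^ (-(1 / p k)) := fun M i k => by positivity
  -- A single admissible choice, `N k = k + 1`, already bounds every column.
  have hcol : ∀ k, ∃ C, ∀ i, |b i k| ≤ C := by
    obtain ⟨C, hC⟩ := h (fun k => k + 1) (fun k => Nat.le_add_left _ _) (tendsto_add_atTop_nat 1)
    intro k
    refine ⟨C / ((k + 1 : ℕ) : ℝ) ^ (-(1 / p k)), fun i => ?_⟩
    rw [le_div_iff₀ (weight_pos (Nat.le_add_left _ _) _)]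
    exact (Finset.single_le_sum (fun k _ => hpos (k + 1) i k) (Finset.self_mem_range_succ k)).trans
      (hC i (k + 1))
  choose D hD using hcol
  have hstep : ∀ M k₀ : ℕ, ∃ k₁, k₀ < k₁ ∧ ∃ i,
      (M : ℝ) < ∑ k ∈ Finset.Ico k₀ k₁, |b i k| * ((M + 1 : ℕ) : ℝ) ^ (-(1 / p k)) := by
    intro M k₀
    -- The threshold includes the column bounds on `[0, k₀)`, so the part beyond `k₀` alone still
    -- exceeds `M`.
    obtain ⟨i, m, him⟩ := hcon' (M + 1) (Nat.le_add_left _ _)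
      (M + ∑ k ∈ Finset.range k₀, D k * ((M + 1 : ℕ) : ℝ) ^ (-(1 / p k)))
    refine ⟨max m (k₀ + 1), by omega, i, ?_⟩
    have h1 : ∑ k ∈ Finset.range m, |b i k| * ((M + 1 : ℕ) : ℝ) ^ (-(1 / p k)) ≤
        ∑ k ∈ Finset.range (max m (k₀ + 1)), |b i k| * ((M + 1 : ℕ) : ℝ) ^ (-(1 / p k)) :=
      Finset.sum_le_sum_of_subset_of_nonneg
        (Finset.range_subset_range.2 (le_max_left _ _)) fun k _ _ => hpos _ i k
    have h2 : ∑ k ∈ Finset.range k₀, |b i k| * ((M + 1 : ℕ) : ℝ) ^ (-(1 / p k)) ≤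
        ∑ k ∈ Finset.range k₀, D k * ((M + 1 : ℕ) : ℝ) ^ (-(1 / p k)) :=
      Finset.sum_le_sum fun k _ => mul_le_mul_of_nonneg_right (hD k i)
        (weight_pos (Nat.le_add_left _ _) _).le
    rw [Finset.sum_Ico_eq_sub _ (by omega)]
    linarith
  choose next hnext row hrow using hstep
  -- Humps live on the blocks `[K i, K (i + 1))`. `idx k` is the block containing `k`, so `N = idx +
  -- 1` tends to infinity yet equals `i + 1` on block `i`, where the sum exceeds `i`.
  let K : ℕ → ℕ := fun n => Nat.rec (motive := fun _ => ℕ) 0 (fun i k => next i k) n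
  have hK : StrictMono K := strictMono_nat_of_lt_succ fun i => hnext i (K i)
  let idx : ℕ → ℕ := fun k => Nat.findGreatest (fun i : ℕ => K i ≤ k) k
  have hle : ∀ i k, K i ≤ k → i ≤ idx k := fun i k h =>
    Nat.le_findGreatest (P := fun i => K i ≤ k) ((hK.id_le i).trans h) h
  have hidx : ∀ i k, K i ≤ k → k < K (i + 1) → idx k = i := fun i k h1 h2 => by
    refine le_antisymm (Nat.lt_succ_iff.1 (hK.lt_iff_lt.1 (lt_of_le_of_lt ?_ h2))) (hle i k h1)
    exact Nat.findGreatest_spec (P := fun i => K i ≤ k) (Nat.zero_le k) (Nat.zero_le k)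
  obtain ⟨C, hC⟩ := h (fun k => idx k + 1) (fun k => Nat.le_add_left _ _) <|
    (tendsto_add_atTop_nat 1).comp <| tendsto_atTop.2 fun i =>
      eventually_atTop.2 ⟨K i, hle i⟩
  obtain ⟨i, hi⟩ := exists_nat_gt C
  have h1 := hrow i (K i)
  have h2 : ∑ k ∈ Finset.Ico (K i) (K (i + 1)),
        |b (row i (K i)) k| * ((i + 1 : ℕ) : ℝ) ^ (-(1 / p k)) =
      ∑ k ∈ Finset.Ico (K i) (K (i + 1)),
        |b (row i (K i)) k| * ((idx k + 1 : ℕ) : ℝ) ^ (-(1 / p k)) :=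
    Finset.sum_congr rfl fun k hk => by
      rw [hidx i k (Finset.mem_Ico.1 hk).1 (Finset.mem_Ico.1 hk).2]
  have h3 : ∑ k ∈ Finset.Ico (K i) (K (i + 1)),
        |b (row i (K i)) k| * ((idx k + 1 : ℕ) : ℝ) ^ (-(1 / p k)) ≤
      ∑ k ∈ Finset.range (K (i + 1)),
        |b (row i (K i)) k| * ((idx k + 1 : ℕ) : ℝ) ^ (-(1 / p k)) :=
    Finset.sum_le_sum_of_subset_of_nonneg
      (fun k hk => Finset.mem_range.2 (Finset.mem_Ico.1 hk).2) fun k _ _ => hpos _ _ k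
  have h4 := hC (row i (K i)) (K (i + 1))
  have h5 : next i (K i) = K (i + 1) := rfl
  rw [h5] at h1
  linarith

/-- For fixed `N → ∞`, the rows multiplied by `N_k^{-1/p_k}` lie in `ℓ¹` and act pointwise boundedly
on bounded sequences, so their `ℓ¹` norms are bounded. -/
theorem weightBdd_of_forall_bdd {ι : Type*} {p : ℕ → ℝ} {b : ι → ℕ → ℝ} (hp : ∀ k, 0 < p k)
    (hpb : BddAbove (Set.range p)) (hs : ∀ y ∈ c0 p, ∀ i, Summable fun k => |b i k * y k|)
    (h : ∀ y ∈ c0 p, ∃ C, ∀ i, |∑' k, b i k * y k| ≤ C) : WeightBdd p b := by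
  refine weightBdd_of_forall_tendsto fun N hN1 hN => ?_
  have ha : ∀ i, Summable fun k => |b i k * (N k : ℝ) ^ (-(1 / p k))| := fun i => by
    simpa using hs _ (mul_weight_mem_c0 (u := fun _ => 1) (C := 1) hp hpb hN (by simp)) i
  obtain ⟨C, hC⟩ := exists_tsum_abs_le ha fun u B hu => by
    simpa only [mul_assoc] using h _ (mul_weight_mem_c0 hp hpb hN hu)
  refine ⟨C, fun i m => le_trans ?_ (hC i)⟩
  refine le_trans (le_of_eq ?_) ((ha i).sum_le_tsum (Finset.range m) fun k _ => abs_nonneg _)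
  exact Finset.sum_congr rfl fun k _ => by rw [abs_mul, abs_of_pos (weight_pos (hN1 k) _)]

/-! ### Consequences of `WeightBdd`: summability and passage to the limit -/

theorem WeightBdd.exists_sum_abs_mul_le {ι : Type*} {p y : ℕ → ℝ} {b : ι → ℕ → ℝ}
    (hb : WeightBdd p b) (hp : ∀ k, 0 < p k) (hpb : BddAbove (Set.range p)) (hy : y ∈ c0 p) :
    ∃ C, ∀ i m, ∑ k ∈ Finset.range m, |b i k * y k| ≤ C := by
  obtain ⟨M, hM, C, hC⟩ := hb
  obtain ⟨D, hD, hyD⟩ := exists_forall_le_of_mem_c0 hp hpb hy hM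
  refine ⟨D * C, fun i m => ?_⟩
  calc ∑ k ∈ Finset.range m, |b i k * y k|
      ≤ ∑ k ∈ Finset.range m, D * (|b i k| * (M : ℝ) ^ (-(1 / p k))) :=
        Finset.sum_le_sum fun k _ => by
          rw [abs_mul, mul_left_comm]
          exact mul_le_mul_of_nonneg_left (hyD k) (abs_nonneg _)
    _ ≤ D * C := by
        rw [← Finset.mul_sum]
        exact mul_le_mul_of_nonneg_left (hC i m) hD

theorem WeightBdd.summable {ι : Type*} {p y : ℕ → ℝ} {b : ι → ℕ → ℝ}
    (hb : WeightBdd p b) (hp : ∀ k, 0 < p k) (hpb : BddAbove (Set.range p)) (hy : y ∈ c0 p)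
    (i : ι) : Summable fun k => |b i k * y k| := by
  obtain ⟨C, hC⟩ := hb.exists_sum_abs_mul_le hp hpb hy
  exact summable_of_sum_range_le (fun k => abs_nonneg _) (hC i)

theorem abs_tsum_le_tsum_abs {a : ℕ → ℝ} (ha : Summable fun k => |a k|) :
    |∑' k, a k| ≤ ∑' k, |a k| :=
  norm_tsum_le_tsum_norm (f := a) (by simpa only [Real.norm_eq_abs] using ha)

theorem WeightBdd.exists_abs_tsum_le {ι : Type*} {p y : ℕ → ℝ} {b : ι → ℕ → ℝ}
    (hb : WeightBdd p b) (hp : ∀ k, 0 < p k) (hpb : BddAbove (Set.range p)) (hy : y ∈ c0 p) :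
    ∃ C, ∀ i, |∑' k, b i k * y k| ≤ C := by
  obtain ⟨C, hC⟩ := hb.exists_sum_abs_mul_le hp hpb hy
  exact ⟨C, fun i => (abs_tsum_le_tsum_abs (hb.summable hp hpb hy i)).trans
    (Real.tsum_le_of_sum_range_le (fun k => abs_nonneg _) (hC i))⟩

/-- Beyond some `N`, `|y_k|` is at most a small multiple of the weight, so the tail is small
uniformly in `n`; the head has finitely many columns, each tending to zero. -/
theorem WeightBdd.tendsto_tsum_zero {p y : ℕ → ℝ} {b : ℕ → ℕ → ℝ}
    (hb : WeightBdd p b) (hp : ∀ k, 0 < p k) (hpb : BddAbove (Set.range p)) (hy : y ∈ c0 p)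
    (hcol : ∀ k, Tendsto (fun n => b n k) atTop (𝓝 0)) :
    Tendsto (fun n => ∑' k, b n k * y k) atTop (𝓝 0) := by
  have hsum := hb.summable hp hpb hy
  obtain ⟨M, hM, C, hC⟩ := hb
  have hC0 : 0 ≤ C := by simpa using hC 0 0
  rw [Metric.tendsto_atTop']
  intro ε hε
  have hδ : 0 < ε / (2 * (C + 1)) := by positivity
  obtain ⟨N, hN⟩ := eventually_atTop.1 (eventually_le_of_mem_c0 hp hpb hy hM hδ)
  have hhead : Tendsto (fun n => ∑ k ∈ Finset.range N, |b n k * y k|) atTop (𝓝 0) := by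
    simpa using tendsto_finsetSum (Finset.range N) fun k _ => ((hcol k).mul_const (y k)).abs
  obtain ⟨n₀, hn₀⟩ := eventually_atTop.1 (hhead.eventually (gt_mem_nhds (half_pos hε)))
  refine ⟨n₀, fun n hn => ?_⟩
  rw [Real.dist_eq, sub_zero]
  refine (abs_tsum_le_tsum_abs (hsum n)).trans_lt ?_
  rw [← (hsum n).sum_add_tsum_nat_add N]
  have htail : ∑' k, |b n (k + N) * y (k + N)| ≤ ε / 2 := by
    refine Real.tsum_le_of_sum_range_le (fun k => abs_nonneg _) fun m => ?_
    calc ∑ k ∈ Finset.range m, |b n (k + N) * y (k + N)|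
        ≤ ∑ k ∈ Finset.range m, ε / (2 * (C + 1)) *
            (|b n (N + k)| * (M : ℝ) ^ (-(1 / p (N + k)))) :=
          Finset.sum_le_sum fun k _ => by
            rw [abs_mul, mul_left_comm, add_comm k]
            exact mul_le_mul_of_nonneg_left (hN _ (Nat.le_add_right _ _)) (abs_nonneg _)
      _ ≤ ε / (2 * (C + 1)) * C := by
          rw [← Finset.mul_sum]
          refine mul_le_mul_of_nonneg_left ?_ hδ.le
          refine le_trans ?_ (hC n (N + m))
          rw [Finset.sum_range_add]
          exact le_add_of_nonneg_left (Finset.sum_nonneg fun k _ => by positivity)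
      _ ≤ ε / (2 * (C + 1)) * (C + 1) := mul_le_mul_of_nonneg_left (by linarith) hδ.le
      _ = ε / 2 := by field_simp
  linarith [hn₀ n hn.le]

theorem sum_weight_limit_le {p α : ℕ → ℝ} {b : ℕ → ℕ → ℝ} {M : ℕ} {C : ℝ}
    (hC : ∀ i m, ∑ k ∈ Finset.range m, |b i k| * (M : ℝ) ^ (-(1 / p k)) ≤ C)
    (hcol : ∀ k, Tendsto (fun n => b n k) atTop (𝓝 (α k))) (m : ℕ) :
    ∑ k ∈ Finset.range m, |α k| * (M : ℝ) ^ (-(1 / p k)) ≤ C :=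
  le_of_tendsto' (tendsto_finsetSum _ fun k _ => (hcol k).abs.mul_const _) fun i => hC i m

theorem WeightBdd.limit {p α : ℕ → ℝ} {b : ℕ → ℕ → ℝ} (hb : WeightBdd p b)
    (hcol : ∀ k, Tendsto (fun n => b n k) atTop (𝓝 (α k))) :
    WeightBdd p fun _ : Unit => α := by
  obtain ⟨M, hM, C, hC⟩ := hb
  exact ⟨M, hM, C, fun _ => sum_weight_limit_le hC hcol⟩

theorem WeightBdd.sub_limit {p α : ℕ → ℝ} {b : ℕ → ℕ → ℝ} (hb : WeightBdd p b)
    (hcol : ∀ k, Tendsto (fun n => b n k) atTop (𝓝 (α k))) :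
    WeightBdd p fun n k => b n k - α k := by
  obtain ⟨M, hM, C, hC⟩ := hb
  refine ⟨M, hM, C + C, fun i m => ?_⟩
  calc ∑ k ∈ Finset.range m, |b i k - α k| * (M : ℝ) ^ (-(1 / p k))
      ≤ ∑ k ∈ Finset.range m,
          (|b i k| * (M : ℝ) ^ (-(1 / p k)) + |α k| * (M : ℝ) ^ (-(1 / p k))) :=
        Finset.sum_le_sum fun k _ => by
          rw [← add_mul]
          exact mul_le_mul_of_nonneg_right (abs_sub _ _) (weight_pos hM _).le
    _ ≤ C + C := by
        rw [Finset.sum_add_distrib]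
        exact add_le_add (hC i m) (sum_weight_limit_le hC hcol m)

theorem WeightBdd.tendsto_tsum {p y α : ℕ → ℝ} {b : ℕ → ℕ → ℝ}
    (hb : WeightBdd p b) (hp : ∀ k, 0 < p k) (hpb : BddAbove (Set.range p)) (hy : y ∈ c0 p)
    (hcol : ∀ k, Tendsto (fun n => b n k) atTop (𝓝 (α k))) :
    Tendsto (fun n => ∑' k, b n k * y k) atTop (𝓝 (∑' k, α k * y k)) := by
  have h := (hb.sub_limit hcol).tendsto_tsum_zero hp hpb hy fun k => by
    simpa using (hcol k).sub_const (α k)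
  have hα := ((hb.limit hcol).summable hp hpb hy ()).of_abs
  have h' := h.add_const (∑' k, α k * y k)
  rw [zero_add] at h'
  refine h'.congr fun n => ?_
  simp only [sub_mul]
  rw [(hb.summable hp hpb hy n).of_abs.tsum_sub hα, sub_add_cancel]

/-! ### Exponents bounded away from zero and infinity -/

/-- For `t ≤ 1` one has `t^Q ≤ t^{q_n} ≤ t^a`, so the variable exponent is squeezed between fixed
positive ones. -/
theorem tendsto_abs_rpow_iff {q x : ℕ → ℝ} {a Q : ℝ} (ha : 0 < a) (haq : ∀ n, a ≤ q n)
    (hQ : ∀ n, q n ≤ Q) :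
    Tendsto (fun n => |x n| ^ q n) atTop (𝓝 0) ↔ Tendsto x atTop (𝓝 0) := by
  constructor
  · intro h
    rw [Metric.tendsto_atTop']
    intro ε hε
    have hδ : 0 < min ε 1 := lt_min hε one_pos
    obtain ⟨N, hN⟩ := eventually_atTop.1
      (h.eventually (gt_mem_nhds (Real.rpow_pos_of_pos hδ Q)))
    refine ⟨N, fun n hn => ?_⟩
    rw [Real.dist_eq, sub_zero]
    refine lt_of_lt_of_le ?_ (min_le_left ε 1)
    rw [← Real.rpow_lt_rpow_iff (abs_nonneg _) hδ.le (ha.trans_le (haq n))]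
    exact (hN n hn.le).trans_le
      (Real.rpow_le_rpow_of_exponent_ge hδ (min_le_right _ _) (hQ n))
  · intro h
    have habs : Tendsto (fun n => |x n|) atTop (𝓝 0) := by simpa using h.abs
    have hlim : Tendsto (fun n => |x n| ^ a) atTop (𝓝 0) := by
      simpa [Real.zero_rpow ha.ne'] using habs.rpow_const (p := a) (Or.inr ha.le)
    refine squeeze_zero' (.of_forall fun n => Real.rpow_nonneg (abs_nonneg _) _) ?_ hlim
    filter_upwards [habs.eventually (gt_mem_nhds one_pos)] with n hn
    exact Real.rpow_le_rpow_of_exponent_ge' (abs_nonneg _) hn.le ha.le (haq n)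

theorem mem_c0_iff {q x : ℕ → ℝ} (hq : ∀ n, 0 < q n) (hqb : BddAbove (Set.range q))
    (hqm : Monotone q) : x ∈ c0 q ↔ Tendsto x atTop (𝓝 0) := by
  obtain ⟨Q, hQ⟩ := hqb
  exact tendsto_abs_rpow_iff (hq 0) (fun n => hqm (Nat.zero_le n)) fun n => hQ ⟨n, rfl⟩

theorem bddAbove_range_rpow_iff {ι : Type*} {x r : ι → ℝ} {a Q : ℝ} (ha : 0 < a)
    (har : ∀ i, a ≤ r i) (hQ : ∀ i, r i ≤ Q) (hx : ∀ i, 0 ≤ x i) :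
    BddAbove (Set.range fun i => x i ^ r i) ↔ ∃ C, ∀ i, x i ≤ C := by
  constructor
  · rintro ⟨S, hS⟩
    refine ⟨max 1 (S ^ a⁻¹), fun i => ?_⟩
    rcases le_total (x i) 1 with h | h
    · exact h.trans (le_max_left _ _)
    · refine le_trans ?_ (le_max_right _ _)
      rw [Real.le_rpow_inv_iff_of_pos (hx i) _ ha]
      · exact (Real.rpow_le_rpow_of_exponent_le h (har i)).trans (hS ⟨i, rfl⟩)
      · exact (Real.rpow_nonneg (hx i) _).trans (hS ⟨i, rfl⟩)
  · rintro ⟨C, hC⟩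
    refine ⟨max C 1 ^ Q, ?_⟩
    rintro _ ⟨i, rfl⟩
    exact (Real.rpow_le_rpow (hx i) ((hC i).trans (le_max_left _ _)) (ha.le.trans (har i))).trans
      (Real.rpow_le_rpow_of_exponent_le (le_max_right _ _) (hQ i))

theorem mem_ellInfty_iff {q x : ℕ → ℝ} (hq : ∀ n, 0 < q n) (hqb : BddAbove (Set.range q))
    (hqm : Monotone q) : x ∈ ellInfty q ↔ ∃ C, ∀ n, |x n| ≤ C := by
  obtain ⟨Q, hQ⟩ := hqb
  exact bddAbove_range_rpow_iff (hq 0) (fun n => hqm (Nat.zero_le n)) (fun n => hQ ⟨n, rfl⟩)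
    fun n => abs_nonneg (x n)

theorem mem_c_iff {q x : ℕ → ℝ} (hq : ∀ n, 0 < q n) (hqb : BddAbove (Set.range q))
    (hqm : Monotone q) : x ∈ c q ↔ ∃ l, Tendsto x atTop (𝓝 l) :=
  exists_congr fun l =>
    (mem_c0_iff (x := fun n => x n - l) hq hqb hqm).trans tendsto_sub_nhds_zero_iff

theorem colLim_iff {q : ℕ → ℝ} (hq : ∀ n, 0 < q n) (hqb : BddAbove (Set.range q))
    (hqm : Monotone q) (e : Matrix ℕ ℕ ℝ) (α : ℕ → ℝ) :
    ColLim q e α ↔ ∀ k, Tendsto (fun n => e n k) atTop (𝓝 (α k)) :=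
  forall_congr' fun k =>
    (mem_c0_iff (x := fun n => e n k - α k) hq hqb hqm).trans tendsto_sub_nhds_zero_iff

theorem colNull_iff {q : ℕ → ℝ} (hq : ∀ n, 0 < q n) (hqb : BddAbove (Set.range q))
    (hqm : Monotone q) (e : Matrix ℕ ℕ ℝ) :
    ColNull q e ↔ ∀ k, Tendsto (fun n => e n k) atTop (𝓝 0) :=
  forall_congr' fun k => mem_c0_iff (x := fun n => e n k) hq hqb hqm

/-! ### The boundedness conditions in terms of `WeightBdd` -/

theorem powBdd_iff {p q : ℕ → ℝ} (hq : ∀ n, 0 < q n) (hqb : BddAbove (Set.range q))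
    (hqm : Monotone q) (e : Matrix ℕ ℕ ℝ) : PowBdd p q e ↔ WeightBdd p e := by
  obtain ⟨Q, hQ⟩ := hqb
  refine exists_congr fun M => and_congr_right fun hM => ?_
  have hpos : ∀ n k, 0 ≤ |e n k| * (M : ℝ) ^ (-(1 / p k)) := fun n k => by positivity
  rw [bddAbove_range_rpow_iff (ι := ℕ × Finset ℕ) (r := fun s => q s.1)
    (x := fun s => ∑ k ∈ s.2, |e s.1 k| * (M : ℝ) ^ (-(1 / p k))) (hq 0)
    (fun s => hqm (Nat.zero_le s.1)) (fun s => hQ ⟨s.1, rfl⟩)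
    fun s => Finset.sum_nonneg fun k _ => hpos _ k]
  refine exists_congr fun C => ⟨fun h n m => h (n, Finset.range m), fun h s => ?_⟩
  obtain ⟨m, hm⟩ := s.2.exists_nat_subset_range
  exact (Finset.sum_le_sum_of_subset_of_nonneg hm fun k _ _ => hpos _ k).trans (h s.1 m)

theorem iSup_tsum_ofReal_lt_top_iff {ι : Type*} {g : ι → ℕ → ℝ} (hg : ∀ i k, 0 ≤ g i k) :
    (⨆ i, ∑' k, ENNReal.ofReal (g i k)) < ∞ ↔
      ∃ C, ∀ i m, ∑ k ∈ Finset.range m, g i k ≤ C := by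
  constructor
  · intro h
    refine ⟨(⨆ i, ∑' k, ENNReal.ofReal (g i k)).toReal, fun i m => ?_⟩
    rw [← ENNReal.ofReal_le_iff_le_toReal h.ne, ENNReal.ofReal_sum_of_nonneg fun k _ => hg i k]
    exact (ENNReal.sum_le_tsum _).trans (le_iSup (fun i => ∑' k, ENNReal.ofReal (g i k)) i)
  · rintro ⟨C, hC⟩
    refine (iSup_le fun i => ENNReal.tsum_le_of_sum_range_le fun m => ?_).trans_lt
      (ENNReal.ofReal_lt_top (r := C))
    rw [← ENNReal.ofReal_sum_of_nonneg fun k _ => hg i k]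
    exact ENNReal.ofReal_le_ofReal (hC i m)

theorem rowBdd_iff {p : ℕ → ℝ} (e : Matrix ℕ ℕ ℝ) : RowBdd p e ↔ WeightBdd p e :=
  exists_congr fun _ => and_congr_right fun _ =>
    iSup_tsum_ofReal_lt_top_iff fun _ _ => by positivity

/-- Because `1 ≤ L^{1/q_n} ≤ L^{1/q_0}`, the factor costs only a constant, and the same `M` serves
every `L`. -/
theorem rowBddL_iff {p q : ℕ → ℝ} (hq : ∀ n, 0 < q n) (hqm : Monotone q) (d : Matrix ℕ ℕ ℝ) :
    RowBddL p q d ↔ WeightBdd p d := by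
  constructor
  · intro h
    refine (rowBdd_iff d).1 ?_
    simpa [RowBdd] using h 1 le_rfl
  · rintro ⟨M, hM, C, hC⟩ L hL
    have hL' : (1 : ℝ) ≤ L := by exact_mod_cast hL
    refine ⟨M, hM, (iSup_tsum_ofReal_lt_top_iff fun _ _ => by positivity).2
      ⟨(L : ℝ) ^ (1 / q 0) * C, fun n m => ?_⟩⟩
    refine le_trans ?_ (mul_le_mul_of_nonneg_left (hC n m) (by positivity))
    rw [Finset.mul_sum]
    refine Finset.sum_le_sum fun k _ => ?_
    rw [mul_right_comm, mul_comm]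
    refine mul_le_mul_of_nonneg_right (Real.rpow_le_rpow_of_exponent_le hL' ?_) (by positivity)
    exact one_div_le_one_div_of_le (hq 0) (hqm (Nat.zero_le n))

/-- `partialE A n m k` is an empty sum for `k > m`, so cutting at `m` loses nothing. -/
theorem partialBdd_iff {p : ℕ → ℝ} (A : Matrix ℕ ℕ ℝ) :
    PartialBdd p A ↔ ∀ n, WeightBdd p (partialE A n) := by
  refine forall_congr' fun n => exists_congr fun M => and_congr_right fun hM => ?_
  have hpos : ∀ m k, 0 ≤ |partialE A n m k| * (M : ℝ) ^ (-(1 / p k)) := fun m k => by positivity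
  have hzero : ∀ m k, m < k → |partialE A n m k| * (M : ℝ) ^ (-(1 / p k)) = 0 := fun m k h => by
    simp [partialE, Finset.Icc_eq_empty_of_lt h]
  constructor
  · rintro ⟨C, hC⟩
    refine ⟨C, fun m j => le_trans ?_ (hC ⟨m, rfl⟩)⟩
    rcases le_total j (m + 1) with h | h
    · exact Finset.sum_le_sum_of_subset_of_nonneg (Finset.range_subset_range.2 h)
        fun k _ _ => hpos m k
    · refine (Finset.sum_subset (Finset.range_subset_range.2 h) fun k _ hk => hzero m k ?_).ge
      simpa using hk
  · rintro ⟨C, hC⟩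
    refine ⟨C, ?_⟩
    rintro _ ⟨m, rfl⟩
    exact hC m (m + 1)

theorem PartialBdd.partialBddL {p : ℕ → ℝ} {A : Matrix ℕ ℕ ℝ} (h : PartialBdd p A)
    (q : ℕ → ℝ) : PartialBddL p q A := by
  intro n L _
  obtain ⟨M, hM, C, hC⟩ := h n
  refine ⟨M, hM, (L : ℝ) ^ (1 / q n) * C, ?_⟩
  rintro _ ⟨m, rfl⟩
  refine le_trans (le_of_eq ?_)
    (mul_le_mul_of_nonneg_left (hC ⟨m, rfl⟩) (Real.rpow_nonneg (Nat.cast_nonneg L) _))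
  rw [Finset.mul_sum]
  exact Finset.sum_congr rfl fun k _ => by ring

/-! ### Inverting the Fibonacci transform -/

theorem f_pos (n : ℕ) : 0 < f n := by
  unfold f
  exact_mod_cast Nat.fib_pos.2 n.succ_pos

/-- The inverse of `fibTransform`. -/
noncomputable def fibInverse (y : ℕ → ℝ) (n : ℕ) : ℝ :=
  ∑ j ∈ Finset.range (n + 1), f (n + 1) ^ 2 / (f j * f (j + 1)) * y j

/-- Only the factor `f (n + 1) ^ 2` depends on `n`, so all but the last term is a rescaling of the
previous value. -/
theorem fibInverse_succ (y : ℕ → ℝ) (n : ℕ) :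
    fibInverse y (n + 1) =
      f (n + 2) / f (n + 1) * (y (n + 1) + f (n + 2) / f (n + 1) * fibInverse y n) := by
  have h1 := (f_pos (n + 1)).ne'
  have h2 := (f_pos (n + 2)).ne'
  have h : ∑ j ∈ Finset.range (n + 1), f (n + 2) ^ 2 / (f j * f (j + 1)) * y j =
      (f (n + 2) / f (n + 1)) ^ 2 * fibInverse y n := by
    rw [fibInverse, Finset.mul_sum]
    refine Finset.sum_congr rfl fun j _ => ?_
    have h3 := (f_pos j).ne'
    have h4 := (f_pos (j + 1)).ne'
    field_simp
  rw [fibInverse, Finset.sum_range_succ, h]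
  field_simp
  ring

theorem fibTransform_fibInverse (y : ℕ → ℝ) : fibTransform (fibInverse y) = y := by
  funext n
  have h0 := (f_pos 0).ne'
  have h1 := (f_pos (n + 1)).ne'
  have h2 := (f_pos (n + 2)).ne'
  cases n with
  | zero => simp [fibTransform, fibInverse]; field_simp
  | succ n =>
    have h1 := (f_pos (n + 1)).ne'
    rw [fibTransform, fibInverse_succ]
    field_simp
    ring

theorem fibInverse_fibTransform (x : ℕ → ℝ) : fibInverse (fibTransform x) = x := by
  funext n
  induction n with
  | zero =>
    have h0 := (f_pos 0).ne'
    have h1 := (f_pos 1).ne'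
    simp [fibTransform, fibInverse]; field_simp
  | succ n ih =>
    have h1 := (f_pos (n + 1)).ne'
    have h2 := (f_pos (n + 2)).ne'
    rw [fibInverse_succ, ih, fibTransform]
    field_simp
    ring

/-- Interchange of summation over the triangle `j ≤ k ≤ m`; the right-hand series has finite
support. -/
theorem sum_mul_fibInverse (A : Matrix ℕ ℕ ℝ) (y : ℕ → ℝ) (n m : ℕ) :
    ∑ k ∈ Finset.range (m + 1), A n k * fibInverse y k = ∑' k, partialE A n m k * y k := by
  rw [tsum_eq_sum (s := Finset.range (m + 1))]
  · simp only [fibInverse, partialE, Finset.mul_sum, Finset.sum_mul]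
    rw [Finset.sum_comm' (t' := Finset.range (m + 1)) (s' := fun j => Finset.Icc j m)]
    · exact Finset.sum_congr rfl fun j _ => Finset.sum_congr rfl fun k _ => by ring
    · intro k j
      simp only [Finset.mem_range, Finset.mem_Icc]
      omega
  · intro k hk
    simp [partialE, Finset.Icc_eq_empty_of_lt (show m < k by simpa using hk)]

/-! ### Reduction of the matrix class to conditions on `partialE` and `E` -/

theorem mem_matrixClass_c0Fib_iff {p : ℕ → ℝ} {A : Matrix ℕ ℕ ℝ} {Y : Set (ℕ → ℝ)} :
    A ∈ matrixClass (c0Fib p) Y ↔ ∀ y ∈ c0 p, ∃ z ∈ Y, ∀ n,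
      Tendsto (fun m => ∑' k, partialE A n m k * y k) atTop (𝓝 (z n)) := by
  have key : ∀ y z : ℕ → ℝ, IsTransform A (fibInverse y) z ↔ ∀ n,
      Tendsto (fun m => ∑' k, partialE A n m k * y k) atTop (𝓝 (z n)) := fun y z =>
    forall_congr' fun n => by
      rw [← tendsto_add_atTop_iff_nat 1]
      simp only [sum_mul_fibInverse]
  constructor
  · intro h y hy
    obtain ⟨z, hz, hAz⟩ := h (fibInverse y) (by
      change fibTransform (fibInverse y) ∈ c0 p
      rwa [fibTransform_fibInverse])
    exact ⟨z, hz, (key y z).1 hAz⟩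
  · intro h x hx
    obtain ⟨z, hz, hAz⟩ := h (fibTransform x) hx
    refine ⟨z, hz, ?_⟩
    rw [← fibInverse_fibTransform x]
    exact (key _ z).2 hAz

theorem single_mem_c0 {p : ℕ → ℝ} (hp : ∀ k, 0 < p k) (k : ℕ) : Pi.single k 1 ∈ c0 p := by
  refine tendsto_const_nhds.congr' ?_
  filter_upwards [eventually_gt_atTop k] with j hj
  simp [Pi.single_eq_of_ne hj.ne', Real.zero_rpow (hp j).ne']

theorem tsum_mul_single (a : ℕ → ℝ) (k : ℕ) :
    ∑' j, a j * (Pi.single k 1 : ℕ → ℝ) j = a k := by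
  rw [tsum_eq_single k fun j hj => by simp [Pi.single_eq_of_ne hj]]
  simp

theorem PartialConv.tendsto {A : Matrix ℕ ℕ ℝ} (h : PartialConv A) (n k : ℕ) :
    Tendsto (fun m => partialE A n m k) atTop (𝓝 (E A n k)) := by
  obtain ⟨α, hα⟩ := h n
  exact tendsto_nhds_limUnder
    ⟨α k, tendsto_sub_nhds_zero_iff.1 ((tendsto_zero_iff_abs_tendsto_zero _).2 (hα k))⟩

/-- Membership in `(c₀(F̂, p) : Y)` splits into conditions on the rows and a condition on `E A`. -/
theorem mem_matrixClass_c0Fib_iff_E {p : ℕ → ℝ} (hp : ∀ k, 0 < p k)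
    (hpb : BddAbove (Set.range p)) {A : Matrix ℕ ℕ ℝ} {Y : Set (ℕ → ℝ)} :
    A ∈ matrixClass (c0Fib p) Y ↔ PartialConv A ∧ PartialBdd p A ∧
      ∀ y ∈ c0 p, (fun n => ∑' k, E A n k * y k) ∈ Y := by
  rw [mem_matrixClass_c0Fib_iff, partialBdd_iff]
  constructor
  · intro h
    have hconv : PartialConv A := by
      intro n
      -- Unit vectors read off the columns.
      choose z _ hz using fun k => h _ (single_mem_c0 hp k)
      refine ⟨fun k => z k n, fun k => (tendsto_zero_iff_abs_tendsto_zero _).1 ?_⟩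
      simpa only [tsum_mul_single] using tendsto_sub_nhds_zero_iff.2 (hz k n)
    have hrow : ∀ n, WeightBdd p (partialE A n) := by
      intro n
      refine weightBdd_of_forall_bdd hp hpb (fun y _ m => ?_) fun y hy => ?_
      · refine summable_of_ne_finset_zero (s := Finset.range (m + 1)) fun k hk => ?_
        simp [partialE, Finset.Icc_eq_empty_of_lt (show m < k by simpa using hk)]
      · obtain ⟨z, _, hz⟩ := h y hy
        -- With `n` fixed, convergence in `m` gives the pointwise bound needed for uniform
        -- boundedness.
        obtain ⟨C, hC⟩ := (hz n).abs.bddAbove_range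
        exact ⟨C, fun m => hC ⟨m, rfl⟩⟩
    refine ⟨hconv, hrow, fun y hy => ?_⟩
    obtain ⟨z, hz, hAz⟩ := h y hy
    convert hz using 1
    exact funext fun n =>
      tendsto_nhds_unique ((hrow n).tendsto_tsum hp hpb hy (hconv.tendsto n)) (hAz n)
  · rintro ⟨hconv, hrow, hY⟩ y hy
    exact ⟨_, hY y hy, fun n => (hrow n).tendsto_tsum hp hpb hy (hconv.tendsto n)⟩

/-- Each row of `E A` is a limit of the rows `partialE A n m` and inherits their weighted bound;
this provides the summability that uniform boundedness over `n` requires. -/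
theorem weightBdd_E {p : ℕ → ℝ} (hp : ∀ k, 0 < p k) (hpb : BddAbove (Set.range p))
    {A : Matrix ℕ ℕ ℝ} (hconv : PartialConv A) (hrow : PartialBdd p A)
    (h : ∀ y ∈ c0 p, ∃ C, ∀ n, |∑' k, E A n k * y k| ≤ C) : WeightBdd p (E A) :=
  weightBdd_of_forall_bdd hp hpb (fun _ hy n =>
    (((partialBdd_iff A).1 hrow n).limit (hconv.tendsto n)).summable hp hpb hy ()) h

end FibMaddox

/-! ### The three characterizations -/

open FibMaddox in
theorem theorem3p3 (p q : ℕ → ℝ)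
    (hp : ∀ k, 0 < p k) (hpb : BddAbove (Set.range p))
    (hq : ∀ n, 0 < q n) (hqb : BddAbove (Set.range q)) (hqm : Monotone q)
    (A : Matrix ℕ ℕ ℝ) :
    (A ∈ FibMaddox.matrixClass (FibMaddox.c0Fib p) (FibMaddox.ellInfty q) ↔
      FibMaddox.PartialConv A ∧ FibMaddox.PartialBdd p A ∧ FibMaddox.PartialBddL p q A ∧
        FibMaddox.PowBdd p q (FibMaddox.E A)) ∧
    (A ∈ FibMaddox.matrixClass (FibMaddox.c0Fib p) (FibMaddox.c0 q) ↔
      FibMaddox.PartialConv A ∧ FibMaddox.PartialBdd p A ∧ FibMaddox.PartialBddL p q A ∧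
        FibMaddox.ColNull q (FibMaddox.E A) ∧ FibMaddox.RowBddL p q (FibMaddox.E A)) ∧
    (A ∈ FibMaddox.matrixClass (FibMaddox.c0Fib p) (FibMaddox.c q) ↔
      FibMaddox.PartialConv A ∧ FibMaddox.PartialBdd p A ∧ FibMaddox.PartialBddL p q A ∧
        ∃ α : ℕ → ℝ, FibMaddox.ColLim q (FibMaddox.E A) α ∧ FibMaddox.RowBdd p (FibMaddox.E A) ∧
          FibMaddox.RowBddL p q (fun n k => FibMaddox.E A n k - α k)) := by
  simp only [mem_matrixClass_c0Fib_iff_E hp hpb, mem_ellInfty_iff hq hqb hqm,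
    mem_c0_iff hq hqb hqm, mem_c_iff hq hqb hqm, powBdd_iff hq hqb hqm, colNull_iff hq hqb hqm,
    colLim_iff hq hqb hqm, rowBdd_iff, rowBddL_iff hq hqm]
  have bdd_of_tendsto : ∀ {u : ℕ → ℝ} {l : ℝ}, Tendsto u atTop (𝓝 l) → ∃ C, ∀ n, |u n| ≤ C :=
    fun h => by
      obtain ⟨C, hC⟩ := h.abs.bddAbove_range
      exact ⟨C, fun n => hC ⟨n, rfl⟩⟩
  refine ⟨⟨?_, ?_⟩, ⟨?_, ?_⟩, ⟨?_, ?_⟩⟩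
  · rintro ⟨hconv, hrow, h⟩
    exact ⟨hconv, hrow, hrow.partialBddL q, weightBdd_E hp hpb hconv hrow h⟩
  · rintro ⟨hconv, hrow, -, hE⟩
    exact ⟨hconv, hrow, fun y hy => hE.exists_abs_tsum_le hp hpb hy⟩
  · rintro ⟨hconv, hrow, h⟩
    refine ⟨hconv, hrow, hrow.partialBddL q, fun k => ?_,
      weightBdd_E hp hpb hconv hrow fun y hy => bdd_of_tendsto (h y hy)⟩
    simpa only [tsum_mul_single] using h _ (single_mem_c0 hp k)
  · rintro ⟨hconv, hrow, -, hcol, hE⟩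
    exact ⟨hconv, hrow, fun y hy => hE.tendsto_tsum_zero hp hpb hy hcol⟩
  · rintro ⟨hconv, hrow, h⟩
    have hE := weightBdd_E hp hpb hconv hrow fun y hy => bdd_of_tendsto (h y hy).choose_spec
    choose α hα using fun k => h _ (single_mem_c0 hp k)
    have hcol : ∀ k, Tendsto (fun n => E A n k) atTop (𝓝 (α k)) := fun k => by
      simpa only [tsum_mul_single] using hα k
    exact ⟨hconv, hrow, hrow.partialBddL q, α, hcol, hE,
      (rowBddL_iff hq hqm _).2 (hE.sub_limit hcol)⟩
  -- The bound on `E A - α` is dropped: `WeightBdd.sub_limit` recovers it from `hE` and `hcol`.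
  · rintro ⟨hconv, hrow, -, α, hcol, hE, -⟩
    exact ⟨hconv, hrow, fun y hy => ⟨_, hE.tendsto_tsum hp hpb hy hcol⟩⟩
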